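/- Setting. Let $\varphi_0:\mathbb R^n\to\mathbb R$ and $\Phi:\mathbb R^n\to\mathbb R^m$ be $\mathcal C^2$-smooth around $\bar x\in\mathbb R^n$, let $\bar v\in\mathbb R^m$ and $\bar z:=\Phi(\bar x)$, and let $\theta:\mathbb R^m\to(-\infty,\infty]$ be convex piecewise linear ($\theta\in CPWL$), i.e. there are finitely many $a_i\in\mathbb R^m$, $\alpha_i\in\mathbb R$ (at least one pair) and finitely many $d_j\in\mathbb R^m$, $\beta_j\in\mathbb R$ with $\theta(z)=\max_i(\langle a_i,z\rangle-\alpha_i)$ if $\langle d_j,z\rangle\le\beta_j$ for all $j$, and $\theta(z)=\infty$ otherwise. Let $\partial\theta$ be the subdifferential of convex analysis and $L(x,v):=\varphi_0(x)+\langle\Phi(x),v\rangle$. For $(p_1,p_2)\in\mathbb R^n\times\mathbb R^m$ put $$\Lambda_{p_1p_2}(x):=\{v\in\mathbb R^m\mid p_1=\nabla_xL(x,v),\ v\in\partial\theta(\Phi(x)+p_2)\},\qquad \Lambda_{\rm com}(x):=\Lambda_{00}(x),$$ $$S_{\rm KKT}(p_1,p_2):=\{(x,v)\in\mathbb R^n\times\mathbb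 R^m\mid v\in\Lambda_{p_1p_2}(x)\}.$$ A set-valued mapping $F$ is Lipschitz-like (Aubin) around $(\bar p,\bar q)$ with $\bar q\in F(\bar p)$ if there are neighborhoods $U$ of $\bar p$, $V$ of $\bar q$ and $\ell\ge0$ such that $F(p)\cap V\subset F(p')+\ell\|p-p'\|\mathbb B$ for all $p,p'\in U$, where $\mathbb B$ is the closed unit ball. The graphical derivative $(D\partial\theta)(\bar z,\bar v)(u)$ is the set of all $\eta$ such that $(u,\eta)$ belongs to the (Bouligand) tangent cone to the graph of $\partial\theta$ at $(\bar z,\bar v)$. A multiplier $\bar v\in\Lambda_{\rm com}(\bar x)$ is noncritical if $\xi=0$ is the only solution $\xi\in\mathbb R^n$ of $$0\in\nabla^2_{xx}L(\bar x,\bar v)\xi+\nabla\Phi(\bar x)^*(D\partial\theta)(\bar z,\bar v)(\nabla\Phi(\bar x)\xi).$$ Theorem. Suppose that $S_{\rm KKT}$ is Lipschitz-like around $((0,0),(\bar x,\bar v))$. Then: (i) $\bar x$ is a nondegenerate point of $\Phi$: for every $a$ in the affine hull of $\partial\theta(\bar z)$ there are $s\le m$, an $s\times m$ matrix $B$ whose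 kernel is the orthogonal complement of the linear subspace parallel to the affine hull of $\partial\theta(\bar z)$, and a CPWL function $\vartheta:\mathbb R^s\to(-\infty,\infty]$ such that $\theta(z)=\vartheta(Bz)+\langle a,z\rangle$ for all $z$ around $\bar z$ and $$\nabla\Phi(\bar x)\mathbb R^n+\ker B=\mathbb R^m.$$ (In particular, if $0$ lies in the affine hull of $\partial\theta(\bar z)$, one may take $a=0$, so that $\theta(z)=\vartheta(Bz)$ around $\bar z$.) (ii) There are a neighborhood $O$ of $(0,0)$ and $\varepsilon>0$ such that, for every $(p_1,p_2)\in O$, the set $S_{\rm KKT}(p_1,p_2)$ has a point within distance $\varepsilon$ of $(\bar x,\bar v)$, and for every such point $(x,v)$ one has $\Lambda_{p_1p_2}(x)=\{v\}$. (iii) $\Lambda_{\rm com}(\bar x)=\{\bar v\}$, and the multiplier $\bar v$ is noncritical. -/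

import Mathlib

open Filter Topology
open scoped RealInnerProductSpace

noncomputable section

namespace CompositeKKT

/-- The Euclidean space `ℝᵏ`. -/
abbrev E (k : ℕ) : Type := EuclideanSpace ℝ (Fin k)

/-! ### Set-valued mappings -/

/-- The (Bouligand-Severi) tangent cone to `Ω` at `z`. -/
def bouligandCone {X : Type*} [NormedAddCommGroup X] [NormedSpace ℝ X]
    (Ω : Set X) (z : X) : Set X :=
  {w | ∃ (zs : ℕ → X) (α : ℕ → ℝ), (∀ k, zs k ∈ Ω) ∧ (∀ k, 0 ≤ α k) ∧
    Tendsto zs atTop (𝓝 z) ∧ Tendsto (fun k => α k • (zs k - z)) atTop (𝓝 w)}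

/-- The graph of a set-valued mapping. -/
def gph {X Y : Type*} (F : X → Set Y) : Set (X × Y) := {q | q.2 ∈ F q.1}

/-- The graphical derivative `DF(x, y)(u)` of a set-valued mapping. -/
def graphicalDeriv {X Y : Type*} [NormedAddCommGroup X] [NormedSpace ℝ X]
    [NormedAddCommGroup Y] [NormedSpace ℝ Y] (F : X → Set Y) (x : X) (y : Y) (u : X) : Set Y :=
  {v | (u, v) ∈ bouligandCone (gph F) (x, y)}

/-- The Lipschitz-like (Aubin, pseudo-Lipschitz) property of `F` around `(x, y) ∈ gph F`:
`F x₁ ∩ V ⊆ F x₂ + ℓ ‖x₁ - x₂‖ 𝔹` for all `x₁, x₂ ∈ U`. -/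
def LipschitzLikeAround {X Y : Type*} [NormedAddCommGroup X] [NormedAddCommGroup Y]
    (F : X → Set Y) (x : X) (y : Y) : Prop :=
  y ∈ F x ∧ ∃ U ∈ 𝓝 x, ∃ V ∈ 𝓝 y, ∃ ℓ : ℝ, 0 ≤ ℓ ∧
    ∀ x₁ ∈ U, ∀ x₂ ∈ U, ∀ y₁ ∈ F x₁ ∩ V, ∃ y₂ ∈ F x₂, ‖y₁ - y₂‖ ≤ ℓ * ‖x₁ - x₂‖

/-! ### Convex piecewise linear functions -/

/-- `θ : ℝᵐ → (-∞, ∞]` is convex piecewise linear: it is the maximum of finitely many (at least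
one) affine functions on the polyhedron `{z | ⟨dᵢ, z⟩ ≤ βᵢ}`, and `∞` outside of it. -/
def IsCPWL {m : ℕ} (θ : E m → EReal) : Prop :=
  ∃ (l p : ℕ) (a : Fin (l + 1) → E m) (α : Fin (l + 1) → ℝ) (d : Fin p → E m) (β : Fin p → ℝ),
    ∀ z : E m,
      ((∀ i, ⟪d i, z⟫ ≤ β i) →
        θ z = ((Finset.univ.sup' Finset.univ_nonempty (fun i => ⟪a i, z⟫ - α i) : ℝ) : EReal)) ∧
      (¬ (∀ i, ⟪d i, z⟫ ≤ β i) → θ z = ⊤)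

/-- The subdifferential of convex analysis (empty where `θ` is not finite). -/
def subdiff {m : ℕ} (θ : E m → EReal) (z : E m) : Set (E m) :=
  {v | θ z ≠ ⊤ ∧ θ z ≠ ⊥ ∧ ∀ u : E m, θ z + ((⟪v, u - z⟫ : ℝ) : EReal) ≤ θ u}

/-! ### Critical multipliers of variational systems -/

/-- Lagrange multipliers at `x` of the system `Ψ(x, v) = 0`, `v ∈ ∂θ(Φ(x))`. -/
def multipliers {n m : ℕ} (Ψ : E n → E m → E n) (Φ : E n → E m) (θ : E m → EReal)
    (x : E n) : Set (E m) :=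
  {v | Ψ x v = 0 ∧ v ∈ subdiff θ (Φ x)}

/-- `v` is a critical multiplier at `x`: there is `ξ ≠ 0` with
`0 ∈ ∇ₓΨ(x, v) ξ + ∇Φ(x)^* (D∂θ)(Φ(x), v)(∇Φ(x) ξ)`. -/
def IsCritical {n m : ℕ} (Ψ : E n → E m → E n) (Φ : E n → E m) (θ : E m → EReal)
    (x : E n) (v : E m) : Prop :=
  v ∈ multipliers Ψ Φ θ x ∧ ∃ ξ : E n, ξ ≠ 0 ∧
    ∃ η ∈ graphicalDeriv (subdiff θ) (Φ x) v (fderiv ℝ Φ x ξ),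
      fderiv ℝ (fun y => Ψ y v) x ξ + (fderiv ℝ Φ x).adjoint η = 0

/-- `v` is a noncritical multiplier at `x`. -/
def IsNoncritical {n m : ℕ} (Ψ : E n → E m → E n) (Φ : E n → E m) (θ : E m → EReal)
    (x : E n) (v : E m) : Prop :=
  v ∈ multipliers Ψ Φ θ x ∧ ¬ IsCritical Ψ Φ θ x v

/-! ### Composite optimization: minimize `φ₀(x) + θ(Φ(x))` -/

/-- The Lagrangian `L(x, v) = φ₀(x) + ⟨Φ(x), v⟩`. -/
def lagrangian {n m : ℕ} (φ₀ : E n → ℝ) (Φ : E n → E m) (x : E n) (v : E m) : ℝ :=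
  φ₀ x + ⟪Φ x, v⟫

/-- The partial gradient `∇ₓL(x, v)`. -/
def gradLagrangian {n m : ℕ} (φ₀ : E n → ℝ) (Φ : E n → E m) (x : E n) (v : E m) : E n :=
  gradient (fun y => lagrangian φ₀ Φ y v) x

/-- Lagrange multipliers at `x` for the perturbed problem of minimizing
`φ₀(x) + θ(Φ(x) + p₂) - ⟨p₁, x⟩`. -/
def perturbedMultipliers {n m : ℕ} (φ₀ : E n → ℝ) (Φ : E n → E m) (θ : E m → EReal)
    (p : E n × E m) (x : E n) : Set (E m) :=
  {v | p.1 = gradLagrangian φ₀ Φ x v ∧ v ∈ subdiff θ (Φ x + p.2)}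

/-- The solution map `(p₁, p₂) ↦ (x, v)` of the canonically perturbed KKT system. -/
def solKKT {n m : ℕ} (φ₀ : E n → ℝ) (Φ : E n → E m) (θ : E m → EReal)
    (p : E n × E m) : Set (E n × E m) :=
  {q | p.1 = gradLagrangian φ₀ Φ q.1 q.2 ∧ q.2 ∈ subdiff θ (p.2 + Φ q.1)}

/-- The set `Λ_com(x)` of Lagrange multipliers for the unperturbed problem. -/
def multipliersCom {n m : ℕ} (φ₀ : E n → ℝ) (Φ : E n → E m) (θ : E m → EReal)
    (x : E n) : Set (E m) :=
  multipliers (gradLagrangian φ₀ Φ) Φ θ x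

/-! ### Nondegeneracy -/

/-- `B` and `ϑ` represent `θ` locally around `z` up to the linear function `⟨a, ·⟩`, with `B`
reduced as far as possible: `ϑ` is convex piecewise linear, `θ(y) = ϑ(B y) + ⟨a, y⟩` for all `y`
around `z`, and `ker B` is the orthogonal complement of the subspace parallel to `aff ∂θ(z)`.
If `0 ∈ aff ∂θ(z)`, one may take `a = 0`, and then the representation is `θ = ϑ ∘ B`. -/
def IsLocalReduction {m s : ℕ} (θ : E m → EReal) (z a : E m)
    (B : E m →L[ℝ] E s) (ϑ : E s → EReal) : Prop :=
  IsCPWL ϑ ∧ (∀ᶠ y in 𝓝 z, θ y = ϑ (B y) + ((⟪a, y⟫ : ℝ) : EReal)) ∧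
    LinearMap.ker (B : E m →ₗ[ℝ] E s) = (affineSpan ℝ (subdiff θ z)).directionᗮ

/-- `x` is a nondegenerate point of `Φ` relative to `B`: `∇Φ(x) ℝⁿ + ker B = ℝᵐ`. -/
def IsNondegenerate {n m s : ℕ} (Φ : E n → E m) (x : E n) (B : E m →L[ℝ] E s) : Prop :=
  LinearMap.range (fderiv ℝ Φ x : E n →ₗ[ℝ] E m) ⊔ LinearMap.ker (B : E m →ₗ[ℝ] E s) = ⊤

end CompositeKKT

end

/-! The graph of the subdifferential of `θ` is polyhedral, and each piece carries a linear
structure. Fix `z` near `Φ xbar` with `vbar ∈ subdiff θ z`, and let `L` be the direction of the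
affine hull of `subdiff θ z`. If `v` is a relative interior point of `subdiff θ z`, monotonicity
forces the graph around `(z, v)` into `(z, v) + Lᗮ × L` (`IsCPWL.eventually_graph`). With `v` also
close to `vbar`, `(xbar, v)` solves the KKT system exactly for a small parameter, and the Aubin
property there makes the linearized system on `Lᗮ × L` solvable for every right-hand side up to
arbitrarily small error (`exists_approx_solution`). That system is a square linear map on `E n × L`,
so dense range gives surjectivity, hence injectivity (`eventually_linearization_injective`).

Everything follows from this injectivity. For `z = Φ xbar` and `ξ = 0` it says that the adjoint of
`∇Φ` is injective on `L`: this is nondegeneracy, and it gives uniqueness of multipliers nearby. A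
tangent direction to the graph at `(Φ xbar, vbar)` lies in `Lᗮ × L` for some `z` arbitrarily close
to `Φ xbar` (`IsCPWL.exists_face_of_graphicalDeriv`), so injectivity there excludes critical
directions. -/

namespace CompositeKKT

/-! ### Polyhedral description of the subdifferential -/

section Data

variable {m l q : ℕ}

/-- The maximum of finitely many affine functions. -/
noncomputable def affineMax (a : Fin (l + 1) → E m) (α : Fin (l + 1) → ℝ) (z : E m) : ℝ :=
  Finset.univ.sup' Finset.univ_nonempty (fun i => ⟪a i, z⟫ - α i)

/-- `θ` is the maximum of the affine functions `⟪a i, ·⟫ - α i` on the polyhedron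
`⟪d j, ·⟫ ≤ β j`. -/
def IsRepresentedBy (θ : E m → EReal) (a : Fin (l + 1) → E m) (α : Fin (l + 1) → ℝ)
    (d : Fin q → E m) (β : Fin q → ℝ) : Prop :=
  ∀ z : E m, ((∀ i, ⟪d i, z⟫ ≤ β i) → θ z = ((affineMax a α z : ℝ) : EReal)) ∧
    (¬ (∀ i, ⟪d i, z⟫ ≤ β i) → θ z = ⊤)

variable {θ : E m → EReal} {a : Fin (l + 1) → E m} {α : Fin (l + 1) → ℝ}
  {d : Fin q → E m} {β : Fin q → ℝ}

lemma le_affineMax (i : Fin (l + 1)) (z : E m) : ⟪a i, z⟫ - α i ≤ affineMax a α z :=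
  Finset.le_sup' (fun i => ⟪a i, z⟫ - α i) (Finset.mem_univ i)

variable (a α) in
lemma exists_affineMax_eq (z : E m) : ∃ i, ⟪a i, z⟫ - α i = affineMax a α z := by
  obtain ⟨i, -, hi⟩ := Finset.exists_mem_eq_sup' (s := Finset.univ) Finset.univ_nonempty
    (fun i : Fin (l + 1) => ⟪a i, z⟫ - α i)
  exact ⟨i, hi.symm⟩

lemma IsRepresentedBy.mem_subdiff_iff (h : IsRepresentedBy θ a α d β) {z v : E m} :
    v ∈ subdiff θ z ↔ (∀ j, ⟪d j, z⟫ ≤ β j) ∧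
      ∀ u, (∀ j, ⟪d j, u⟫ ≤ β j) → affineMax a α z + ⟪v, u - z⟫ ≤ affineMax a α u := by
  constructor
  · rintro ⟨h1, -, h3⟩
    have hz : ∀ j, ⟪d j, z⟫ ≤ β j := by
      by_contra hz
      exact h1 ((h z).2 hz)
    refine ⟨hz, fun u hu => ?_⟩
    have := h3 u
    rw [(h z).1 hz, (h u).1 hu] at this
    exact_mod_cast this
  · rintro ⟨hz, h3⟩
    refine ⟨?_, ?_, fun u => ?_⟩
    · rw [(h z).1 hz]; exact EReal.coe_ne_top _
    · rw [(h z).1 hz]; exact EReal.coe_ne_bot _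
    · by_cases hu : ∀ j, ⟪d j, u⟫ ≤ β j
      · rw [(h z).1 hz, (h u).1 hu]
        exact_mod_cast h3 u hu
      · rw [(h u).2 hu]; exact le_top

/-- Near a point, only affine pieces active at that point are active, and constraints which are
inactive at that point stay inactive. -/
lemma eventually_active (a : Fin (l + 1) → E m) (α : Fin (l + 1) → ℝ)
    (d : Fin q → E m) (β : Fin q → ℝ) (z : E m) : ∀ᶠ y in 𝓝 z,
    (∀ i, ⟪a i, y⟫ - α i = affineMax a α y → ⟪a i, z⟫ - α i = affineMax a α z) ∧
      ∀ j, ⟪d j, z⟫ < β j → ⟪d j, y⟫ < β j := by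
  obtain ⟨i₀, h₀⟩ := exists_affineMax_eq a α z
  refine Filter.Eventually.and ?_ ?_
  · rw [eventually_all]
    intro i
    by_cases hi : ⟪a i, z⟫ - α i = affineMax a α z
    · exact Eventually.of_forall fun _ _ => hi
    · have hlt : ⟪a i, z⟫ - α i < ⟪a i₀, z⟫ - α i₀ := by
        rw [h₀]; exact lt_of_le_of_ne (le_affineMax i z) hi
      have : ∀ᶠ y in 𝓝 z, ⟪a i, y⟫ - α i < ⟪a i₀, y⟫ - α i₀ :=
        ContinuousAt.eventually_lt (by fun_prop) (by fun_prop) hlt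
      filter_upwards [this] with y hy hy'
      have := le_affineMax (a := a) (α := α) i₀ y
      linarith
  · rw [eventually_all]
    intro j
    by_cases hj : ⟪d j, z⟫ < β j
    · have : ∀ᶠ y in 𝓝 z, ⟪d j, y⟫ < β j :=
        ContinuousAt.eventually_lt (by fun_prop) (by fun_prop) hj
      filter_upwards [this] with y hy _ using hy
    · exact Eventually.of_forall fun _ h => absurd h hj

/-- The convex set generated by the active data `I`, `J`, in dual form. -/
def activeSet (a : Fin (l + 1) → E m) (d : Fin q → E m) (I : Set (Fin (l + 1)))
    (J : Set (Fin q)) : Set (E m) :=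
  {v | ∀ h, (∀ j ∈ J, ⟪d j, h⟫ ≤ 0) → ∃ i ∈ I, ⟪v, h⟫ ≤ ⟪a i, h⟫}

lemma activeSet_mono {I I' : Set (Fin (l + 1))} {J J' : Set (Fin q)} (hI : I ⊆ I')
    (hJ : J ⊆ J') : activeSet a d I J ⊆ activeSet a d I' J' := fun _ hv h hh =>
  let ⟨i, hi, hi'⟩ := hv h fun j hj => hh j (hJ hj)
  ⟨i, hI hi, hi'⟩

/-- A short step from `z` along a direction feasible for the active constraints stays feasible and
meets only pieces active at `z`; conversely the dual condition is tested at `u - z`. Hence only the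
active index sets matter. -/
lemma IsRepresentedBy.subdiff_eq (h : IsRepresentedBy θ a α d β) {z : E m}
    (hz : ∀ j, ⟪d j, z⟫ ≤ β j) :
    subdiff θ z = activeSet a d {i | ⟪a i, z⟫ - α i = affineMax a α z} {j | ⟪d j, z⟫ = β j} := by
  ext v
  rw [h.mem_subdiff_iff]
  constructor
  · rintro ⟨-, hv⟩ w hw
    have hT : Tendsto (fun t : ℝ => z + t • w) (𝓝[>] 0) (𝓝 z) := by
      have : Continuous fun t : ℝ => z + t • w := by fun_prop
      have := this.tendsto 0
      simp only [zero_smul, add_zero] at this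
      exact this.mono_left nhdsWithin_le_nhds
    obtain ⟨t, ⟨h1, h2⟩, ht⟩ :=
      ((hT.eventually (eventually_active a α d β z)).and self_mem_nhdsWithin).exists
    have ht : 0 < t := ht
    have hfeas : ∀ j, ⟪d j, z + t • w⟫ ≤ β j := by
      intro j
      rcases (hz j).lt_or_eq with hj | hj
      · exact (h2 j hj).le
      · rw [inner_add_right, inner_smul_right, hj]
        nlinarith [hw j hj]
    obtain ⟨i, hi⟩ := exists_affineMax_eq a α (z + t • w)
    refine ⟨i, h1 i hi, ?_⟩
    have h3 := hv _ hfeas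
    rw [← hi, ← h1 i hi, add_sub_cancel_left, inner_smul_right, inner_add_right,
      inner_smul_right] at h3
    exact le_of_mul_le_mul_left (by linarith) ht
  · intro hv
    refine ⟨hz, fun u hu => ?_⟩
    obtain ⟨i, hi, hi'⟩ := hv (u - z) fun j hj => by
      have hj : ⟪d j, z⟫ = β j := hj
      rw [inner_sub_right, hj]; linarith [hu j]
    have hi : ⟪a i, z⟫ - α i = affineMax a α z := hi
    have := le_affineMax (a := a) (α := α) i u
    rw [inner_sub_right (a i)] at hi'
    linarith

end Data

/-! ### Finiteness, local inclusion and monotonicity of subdifferentials -/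

section CPWL

variable {m : ℕ} {θ : E m → EReal}

lemma IsCPWL.exists_isRepresentedBy (h : IsCPWL θ) : ∃ (l q : ℕ) (a : Fin (l + 1) → E m)
    (α : Fin (l + 1) → ℝ) (d : Fin q → E m) (β : Fin q → ℝ), IsRepresentedBy θ a α d β := h

lemma IsCPWL.finite_range_subdiff (h : IsCPWL θ) : (Set.range (subdiff θ)).Finite := by
  obtain ⟨l, q, a, α, d, β, h⟩ := h.exists_isRepresentedBy
  refine ((Set.finite_singleton (∅ : Set (E m))).union
    (Set.finite_range fun p : Set (Fin (l + 1)) × Set (Fin q) => activeSet a d p.1 p.2)).subset ?_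
  rintro _ ⟨z, rfl⟩
  by_cases hz : ∀ j, ⟪d j, z⟫ ≤ β j
  · exact Or.inr ⟨(_, _), (h.subdiff_eq hz).symm⟩
  · refine Or.inl (Set.eq_empty_of_forall_notMem fun v hv => hz (h.mem_subdiff_iff.1 hv).1)

/-- Passing to a nearby point can only lose active pieces and constraints, and `activeSet` is
monotone in both. -/
lemma IsCPWL.eventually_subdiff_subset (h : IsCPWL θ) {z : E m} (hz : (subdiff θ z).Nonempty) :
    ∀ᶠ y in 𝓝 z, subdiff θ y ⊆ subdiff θ z := by
  obtain ⟨l, q, a, α, d, β, h⟩ := h.exists_isRepresentedBy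
  obtain ⟨v₀, hv₀⟩ := hz
  have hz := (h.mem_subdiff_iff.1 hv₀).1
  filter_upwards [eventually_active a α d β z] with y hy v hv
  have hy' := (h.mem_subdiff_iff.1 hv).1
  rw [h.subdiff_eq hz]
  rw [h.subdiff_eq hy'] at hv
  refine activeSet_mono (fun i hi => hy.1 i hi) (fun j hj => ?_) hv
  rcases (hz j).lt_or_eq with hlt | heq
  · exact absurd hj (hy.2 j hlt).ne
  · exact heq

lemma IsCPWL.isClosed_subdiff (h : IsCPWL θ) (z : E m) : IsClosed (subdiff θ z) := by
  obtain ⟨l, q, a, α, d, β, h⟩ := h.exists_isRepresentedBy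
  have : subdiff θ z = {v | (∀ j, ⟪d j, z⟫ ≤ β j) ∧ ∀ u, (∀ j, ⟪d j, u⟫ ≤ β j) →
      affineMax a α z + ⟪v, u - z⟫ ≤ affineMax a α u} := by
    ext v; exact h.mem_subdiff_iff
  rw [this]
  simp only [Set.ofPred_and, Set.ofPred_forall]
  exact (isClosed_iInter fun _ => isClosed_const).inter <| isClosed_iInter fun u =>
    isClosed_iInter fun _ => isClosed_le (by fun_prop) (by fun_prop)

lemma IsCPWL.convex_subdiff (h : IsCPWL θ) (z : E m) : Convex ℝ (subdiff θ z) := by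
  obtain ⟨l, q, a, α, d, β, h⟩ := h.exists_isRepresentedBy
  intro x hx y hy s t hs ht hst
  rw [h.mem_subdiff_iff] at hx hy ⊢
  refine ⟨hx.1, fun u hu => ?_⟩
  rw [inner_add_left, real_inner_smul_left, real_inner_smul_left]
  have h1 := mul_le_mul_of_nonneg_left (hx.2 u hu) hs
  have h2 := mul_le_mul_of_nonneg_left (hy.2 u hu) ht
  obtain rfl : t = 1 - s := by linarith
  linarith

/-- The subdifferential is monotone. -/
lemma IsCPWL.inner_nonneg (h : IsCPWL θ) {y z v w : E m} (hv : v ∈ subdiff θ y)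
    (hw : w ∈ subdiff θ z) : 0 ≤ ⟪v - w, y - z⟫ := by
  obtain ⟨l, q, a, α, d, β, h⟩ := h.exists_isRepresentedBy
  rw [h.mem_subdiff_iff] at hv hw
  have h1 := hv.2 z hw.1
  have h2 := hw.2 y hv.1
  rw [← neg_sub y z, inner_neg_right] at h1
  rw [inner_sub_left]
  linarith

/-- The directional subspace of two points sharing subgradients is orthogonal to their
difference. -/
lemma IsCPWL.sub_mem_orthogonal (h : IsCPWL θ) {y z : E m} (hs : subdiff θ y ⊆ subdiff θ z) :
    y - z ∈ (affineSpan ℝ (subdiff θ y)).directionᗮ := by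
  rw [direction_affineSpan, vectorSpan_def, Submodule.mem_orthogonal]
  intro u hu
  induction hu using Submodule.span_induction with
  | mem x hx =>
    obtain ⟨v, hv, w, hw, rfl⟩ := hx
    have h1 := h.inner_nonneg hv (hs hw)
    have h2 := h.inner_nonneg hw (hs hv)
    rw [← neg_sub v w, inner_neg_left] at h2
    simp only [vsub_eq_sub]
    linarith
  | zero => simp
  | add x y _ _ hx hy => rw [inner_add_left, hx, hy, add_zero]
  | smul c x _ hx => rw [real_inner_smul_left, hx, mul_zero]

end CPWL

/-! ### Relative interior points and local flatness of the graph -/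

section RelativeInterior

variable {V : Type*} [NormedAddCommGroup V] [NormedSpace ℝ V]

/-- A convex set in finite dimension has relative interior points arbitrarily close to any of its
points. -/
lemma exists_near_relInterior [FiniteDimensional ℝ V] {C : Set V} (hC : Convex ℝ C) {c : V}
    (hc : c ∈ C) {ε : ℝ} (hε : 0 < ε) :
    ∃ v ∈ C, ‖v - c‖ < ε ∧ ∃ r > 0, ∀ y ∈ affineSpan ℝ C, ‖y - v‖ < r → y ∈ C := by
  obtain ⟨b, hb⟩ := (Set.Nonempty.intrinsicInterior hC ⟨c, hc⟩)
  have hbC := intrinsicInterior_subset hb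
  obtain ⟨b', hb', rfl⟩ := mem_intrinsicInterior.1 hb
  obtain ⟨r, hr, hball⟩ := Metric.mem_nhds_iff.1 (mem_interior_iff_mem_nhds.1 hb')
  have hr' : ∀ y ∈ affineSpan ℝ C, ‖y - b'‖ < r → y ∈ C := fun y hy hyr =>
    hball (show (⟨y, hy⟩ : affineSpan ℝ C) ∈ Metric.ball b' r by
      rw [Metric.mem_ball, Subtype.dist_eq, dist_eq_norm]; exact hyr)
  -- The homothety with centre `c` and ratio `s` moves the relative ball around `b'` to one of
  -- radius `s * r` close to `c`.
  obtain ⟨s, hs0, hs1, hs⟩ : ∃ s : ℝ, 0 < s ∧ s ≤ 1 ∧ s * ‖(b' : V) - c‖ < ε := by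
    refine ⟨min 1 (ε / (‖(b' : V) - c‖ + 1)), by positivity, min_le_left _ _, ?_⟩
    have hpos : 0 < ‖(b' : V) - c‖ + 1 := by positivity
    calc _ ≤ ε / (‖(b' : V) - c‖ + 1) * ‖(b' : V) - c‖ := by gcongr; exact min_le_right _ _
      _ < ε / (‖(b' : V) - c‖ + 1) * (‖(b' : V) - c‖ + 1) := by gcongr; linarith
      _ = ε := by field_simp
  have hv : c + s • ((b' : V) - c) = (1 - s) • c + s • (b' : V) := by module
  refine ⟨c + s • ((b' : V) - c), ?_, ?_, s * r, by positivity, fun y hy hyr => ?_⟩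
  · rw [hv]; exact hC hc hbC (by linarith) hs0.le (by ring)
  · rwa [add_sub_cancel_left, norm_smul, Real.norm_of_nonneg hs0.le]
  · have hx : c + s⁻¹ • (y - c) ∈ C := by
      apply hr'
      · have := AffineMap.lineMap_mem (Q := affineSpan ℝ C) s⁻¹ (subset_affineSpan ℝ C hc) hy
        rwa [AffineMap.lineMap_apply_module', add_comm] at this
      · have : c + s⁻¹ • (y - c) - b' = s⁻¹ • (y - (c + s • ((b' : V) - c))) := by
          match_scalars <;> field_simp
          ring
        rw [this, norm_smul, norm_inv, Real.norm_of_nonneg hs0.le, inv_mul_lt_iff₀ hs0]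
        exact hyr
    have : y = (1 - s) • c + s • (c + s⁻¹ • (y - c)) := by
      match_scalars <;> field_simp
      ring
    rw [this]
    exact hC hc hx (by linarith) hs0.le (by ring)

end RelativeInterior

/-- Around a point `(z, v)` of the graph of `∂θ` with `v` a relative interior point of `∂θ(z)`,
the graph is contained in the sum of `(z, v)` and `Lᗮ × L`, where `L` is the subspace parallel to
`aff ∂θ(z)`. -/
lemma IsCPWL.eventually_graph {m : ℕ} {θ : E m → EReal} (h : IsCPWL θ) {z v : E m}
    (hv : v ∈ subdiff θ z) {r : ℝ}
    (hint : ∀ y ∈ affineSpan ℝ (subdiff θ z), ‖y - v‖ < r → y ∈ subdiff θ z) :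
    ∀ᶠ y in 𝓝 z, ∀ w ∈ subdiff θ y, ‖w - v‖ < r →
      w - v ∈ (affineSpan ℝ (subdiff θ z)).direction ∧
        y - z ∈ (affineSpan ℝ (subdiff θ z)).directionᗮ := by
  filter_upwards [h.eventually_subdiff_subset ⟨v, hv⟩] with y hy w hw hwr
  have hwz := subset_affineSpan ℝ _ (hy hw)
  refine ⟨AffineSubspace.vsub_mem_direction hwz (subset_affineSpan ℝ _ hv), ?_⟩
  -- As `w` is in the open relative ball, `w + t • u` is still a subgradient at `z` for small `t >
  -- 0`; monotonicity against `w` at `y` gives the sign, and `-u` gives the opposite one.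
  have key : ∀ u ∈ (affineSpan ℝ (subdiff θ z)).direction, ⟪u, y - z⟫ ≤ 0 := by
    intro u hu
    have hc : Tendsto (fun t : ℝ => ‖t • u + w - v‖) (𝓝[>] 0) (𝓝 ‖w - v‖) := by
      have : Continuous fun t : ℝ => ‖t • u + w - v‖ := by fun_prop
      have := this.tendsto 0
      simp only [zero_smul, zero_add] at this
      exact this.mono_left nhdsWithin_le_nhds
    obtain ⟨t, ht, ht0⟩ := ((hc.eventually (gt_mem_nhds hwr)).and self_mem_nhdsWithin).exists
    have ht0 : 0 < t := ht0
    have hmem : t • u + w ∈ subdiff θ z := hint _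
      (AffineSubspace.vadd_mem_of_mem_direction (Submodule.smul_mem _ t hu) hwz) ht
    have := h.inner_nonneg hw hmem
    rw [show w - (t • u + w) = -(t • u) by abel, inner_neg_left, real_inner_smul_left] at this
    nlinarith
  rw [Submodule.mem_orthogonal]
  intro u hu
  have h2 := key (-u) (Submodule.neg_mem _ hu)
  rw [inner_neg_left] at h2
  linarith [key u hu]

/-! ### First-order calculus of the Lagrangian gradient -/

section Gradient

variable {n m : ℕ} {φ₀ : E n → ℝ} {Φ : E n → E m}

lemma gradLagrangian_eq {x : E n} (hφ₀ : DifferentiableAt ℝ φ₀ x) (hΦ : DifferentiableAt ℝ Φ x)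
    (v : E m) :
    gradLagrangian φ₀ Φ x v = gradient φ₀ x + (fderiv ℝ Φ x).adjoint v := by
  refine HasGradientAt.gradient ?_
  rw [hasGradientAt_iff_hasFDerivAt]
  have h1 := hφ₀.hasFDerivAt
  have h2 := hΦ.hasFDerivAt.inner ℝ (hasFDerivAt_const v x)
  refine (h1.add h2).congr_fderiv ?_
  ext h
  simp [gradient, ContinuousLinearMap.adjoint_inner_left, real_inner_comm]

lemma eventually_gradLagrangian_eq {x : E n} (hφ₀ : ContDiffAt ℝ 2 φ₀ x)
    (hΦ : ContDiffAt ℝ 2 Φ x) : ∀ᶠ y in 𝓝 x, ∀ v,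
      gradLagrangian φ₀ Φ y v = gradient φ₀ y + (fderiv ℝ Φ y).adjoint v := by
  filter_upwards [hφ₀.eventually (by simp), hΦ.eventually (by simp)] with y h1 h2 v
  exact gradLagrangian_eq (h1.differentiableAt (by simp)) (h2.differentiableAt (by simp)) v

/-- Over `ℝ` the conjugate-linear adjoint is a bounded linear map. -/
lemma contDiff_adjoint {k : WithTop ℕ∞} :
    ContDiff ℝ k (fun T : E n →L[ℝ] E m => ContinuousLinearMap.adjoint T) := by
  have : IsBoundedLinearMap ℝ (fun T : E n →L[ℝ] E m => ContinuousLinearMap.adjoint T) :=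
    { map_add := fun _ _ => map_add _ _ _
      map_smul := fun c T => by simp
      bound := ⟨1, one_pos, fun T => by simp⟩ }
  exact this.contDiff

lemma contDiffAt_gradLagrangian {x : E n} (hφ₀ : ContDiffAt ℝ 2 φ₀ x)
    (hΦ : ContDiffAt ℝ 2 Φ x) (v : E m) :
    ContDiffAt ℝ 1 (fun p : E n × E m => gradLagrangian φ₀ Φ p.1 p.2) (x, v) := by
  have h : ContDiffAt ℝ 1 (fun p : E n × E m =>
      gradient φ₀ p.1 + (fderiv ℝ Φ p.1).adjoint p.2) (x, v) := by
    have h1 : ContDiffAt ℝ 1 (fun p : E n × E m => fderiv ℝ φ₀ p.1) (x, v) :=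
      ContDiffAt.comp (x, v) (hφ₀.fderiv_right (m := 1) (by norm_num)) contDiffAt_fst
    have h2 : ContDiffAt ℝ 1 (fun p : E n × E m => fderiv ℝ Φ p.1) (x, v) :=
      ContDiffAt.comp (x, v) (hΦ.fderiv_right (m := 1) (by norm_num)) contDiffAt_fst
    refine ContDiffAt.add ?_ (ContDiffAt.clm_apply ?_ contDiffAt_snd)
    · exact (InnerProductSpace.toDual ℝ (E n)).symm.toContinuousLinearEquiv.contDiff.contDiffAt.comp
        (x, v) h1
    · exact contDiff_adjoint.contDiffAt.comp (x, v) h2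
  refine h.congr_of_eventuallyEq ?_
  filter_upwards [continuous_fst.continuousAt.eventually
    (eventually_gradLagrangian_eq hφ₀ hΦ)] with p hp using hp p.2

lemma fderiv_uncurry_apply {X Y Z : Type*} [NormedAddCommGroup X] [NormedSpace ℝ X]
    [NormedAddCommGroup Y] [NormedSpace ℝ Y] [NormedAddCommGroup Z] [NormedSpace ℝ Z]
    {G : X → Y → Z} {x : X} {v : Y} {D : X × Y →L[ℝ] Z} {D₂ : Y →L[ℝ] Z}
    (h : HasFDerivAt (fun p : X × Y => G p.1 p.2) D (x, v)) (h₂ : HasFDerivAt (G x) D₂ v)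
    (ξ : X) (η : Y) : D (ξ, η) = fderiv ℝ (fun y => G y v) x ξ + D₂ η := by
  have h1 : HasFDerivAt (fun y => G y v) (D.comp (ContinuousLinearMap.inl ℝ X Y)) x :=
    HasFDerivAt.comp (g := fun p : X × Y => G p.1 p.2) (f := fun y => (y, v)) x h
      (hasFDerivAt_prodMk_left x v)
  have h2 : HasFDerivAt (G x) (D.comp (ContinuousLinearMap.inr ℝ X Y)) v :=
    HasFDerivAt.comp (g := fun p : X × Y => G p.1 p.2) (f := fun w => (x, w)) v h
      (hasFDerivAt_prodMk_right x v)
  rw [h1.fderiv, h₂.unique h2, ContinuousLinearMap.comp_apply, ContinuousLinearMap.comp_apply,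
    ← map_add]
  simp

lemma fderiv_gradLagrangian_apply {x : E n} (hφ₀ : ContDiffAt ℝ 2 φ₀ x)
    (hΦ : ContDiffAt ℝ 2 Φ x) (v : E m) (ξ : E n) (η : E m) :
    fderiv ℝ (fun p : E n × E m => gradLagrangian φ₀ Φ p.1 p.2) (x, v) (ξ, η) =
      fderiv ℝ (fun y => gradLagrangian φ₀ Φ y v) x ξ + (fderiv ℝ Φ x).adjoint η := by
  refine fderiv_uncurry_apply
    ((contDiffAt_gradLagrangian hφ₀ hΦ v).differentiableAt (by simp)).hasFDerivAt ?_ ξ η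
  refine ((fderiv ℝ Φ x).adjoint.hasFDerivAt (x := v) |>.const_add
    (gradient φ₀ x)).congr_of_eventuallyEq (Eventually.of_forall fun w => ?_)
  exact (eventually_gradLagrangian_eq hφ₀ hΦ).self_of_nhds w

end Gradient

/-! ### From the Aubin property to nonsingular linearizations -/

section Aubin

variable {n m : ℕ} {φ₀ : E n → ℝ} {Φ : E n → E m} {θ : E m → EReal} {xbar : E n} {vbar : E m}

/-- The Lipschitz-like property of the solution map makes the linearization of the KKT system
along any face of `gph ∂θ` adjacent to the reference point approximately solvable. -/
lemma exists_approx_solution (hθ : IsCPWL θ) {D : E n × E m →L[ℝ] E n} {T : E n →L[ℝ] E m}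
    (hG : HasStrictFDerivAt (fun p : E n × E m => gradLagrangian φ₀ Φ p.1 p.2) D (xbar, vbar))
    (hT : HasStrictFDerivAt Φ T xbar)
    (hLip : LipschitzLikeAround (solKKT φ₀ Φ θ) ((0, 0) : E n × E m) (xbar, vbar)) :
    ∀ᶠ z in 𝓝 (Φ xbar), vbar ∈ subdiff θ z → ∀ (q : E n × E m), ∀ c > 0,
      ∃ (ξ : E n) (η : E m), η ∈ (affineSpan ℝ (subdiff θ z)).direction ∧
        ‖q.1 - D (ξ, η)‖ ≤ c ∧
        ∃ y ∈ (affineSpan ℝ (subdiff θ z)).directionᗮ, ‖y - (q.2 + T ξ)‖ ≤ c := by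
  obtain ⟨⟨h0, -⟩, U, hU, V, hV, ℓ, hℓ, hUV⟩ := hLip
  have h0 : gradLagrangian φ₀ Φ xbar vbar = 0 := h0.symm
  have hshift : Tendsto (fun z => ((0 : E n), z - Φ xbar)) (𝓝 (Φ xbar)) (𝓝 (0, 0)) := by
    have : Continuous fun z => ((0 : E n), z - Φ xbar) := by fun_prop
    simpa using this.tendsto (Φ xbar)
  filter_upwards [hshift.eventually (eventually_mem_nhds_iff.2 hU)] with z hz hvz q c hc
  set L := (affineSpan ℝ (subdiff θ z)).direction with hL
  -- Solutions move by at most `ℓ * t * ‖q‖`, so a linearization error with factor `c'` is at most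
  -- `t * c`; the `+ 1` avoids division by zero.
  set c' : ℝ := c / (ℓ * ‖q‖ + 1) with hc'
  have hpos : 0 < ℓ * ‖q‖ + 1 := by positivity
  have hc'0 : 0 < c' := by positivity
  have hT' : HasStrictFDerivAt (fun p : E n × E m => Φ p.1)
      (T.comp (ContinuousLinearMap.fst ℝ (E n) (E m))) (xbar, vbar) :=
    HasStrictFDerivAt.comp (xbar, vbar) hT hasStrictFDerivAt_fst
  have e1 := hG.isLittleO.def hc'0
  have e2 := hT'.isLittleO.def hc'0
  have e3 : ∀ᶠ y : (E n × E m) × (E n × E m) in 𝓝 ((xbar, vbar), (xbar, vbar)), y.2 ∈ V :=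
    continuous_snd.continuousAt.eventually hV
  obtain ⟨ρ, hρ, hball⟩ := Metric.eventually_nhds_iff.1 ((e1.and e2).and e3)
  have hcont : Tendsto (fun v => (gradLagrangian φ₀ Φ xbar v, z - Φ xbar)) (𝓝 vbar)
      (𝓝 (0, z - Φ xbar)) := by
    have h1 : ContinuousAt (fun v => gradLagrangian φ₀ Φ xbar v) vbar :=
      ContinuousAt.comp (f := fun v : E m => (xbar, v)) hG.continuousAt (by fun_prop)
    have := h1.prodMk (continuousAt_const (y := z - Φ xbar))
    rw [ContinuousAt, h0] at this
    exact this
  obtain ⟨ε, hε, hεU⟩ := Metric.eventually_nhds_iff.1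
    (hcont.eventually (eventually_mem_nhds_iff.2 hz))
  -- Since `v` need not equal `vbar`, the expansion below is based at `(xbar, v)`; strict
  -- differentiability at `(xbar, vbar)` covers this.
  obtain ⟨v, hv, hvε, r, hr, hint⟩ := exists_near_relInterior (hθ.convex_subdiff z) hvz
    (lt_min hε (half_pos hρ))
  have hpU := hεU (y := v) (by rw [dist_eq_norm]; exact hvε.trans_le (min_le_left _ _))
  have hvρ : ‖v - vbar‖ < ρ / 2 := hvε.trans_le (min_le_right _ _)
  set p : E n × E m := (gradLagrangian φ₀ Φ xbar v, z - Φ xbar) with hp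
  have hsol : (xbar, v) ∈ solKKT φ₀ Φ θ p :=
    ⟨rfl, by simpa [hp] using hv⟩
  have hz'' : Tendsto (fun y : E n × ℝ => z - Φ xbar + y.2 • q.2 + Φ y.1) (𝓝 (xbar, 0)) (𝓝 z) := by
    have h1 : ContinuousAt (fun y : E n × ℝ => Φ y.1) (xbar, 0) :=
      ContinuousAt.comp (f := Prod.fst) hT.continuousAt continuousAt_fst
    have h2 : ContinuousAt (fun y : E n × ℝ => z - Φ xbar + y.2 • q.2 + Φ y.1) (xbar, 0) :=
      ContinuousAt.add (by fun_prop) h1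
    rw [ContinuousAt] at h2
    simpa using h2
  obtain ⟨δ, hδ, hδ'⟩ := Metric.eventually_nhds_iff.1
    (hz''.eventually (hθ.eventually_graph hv hint))
  have ht1 : Tendsto (fun t : ℝ => p + t • q) (𝓝[>] 0) (𝓝 p) := by
    have : Continuous fun t : ℝ => p + t • q := by fun_prop
    have := this.tendsto 0
    simp only [zero_smul, add_zero] at this
    exact this.mono_left nhdsWithin_le_nhds
  have ht2 : Tendsto (fun t : ℝ => ℓ * (t * ‖q‖)) (𝓝[>] 0) (𝓝 0) := by
    have : Continuous fun t : ℝ => ℓ * (t * ‖q‖) := by fun_prop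
    have := this.tendsto 0
    simp only [zero_mul, mul_zero] at this
    exact this.mono_left nhdsWithin_le_nhds
  have ht3 : ∀ᶠ t : ℝ in 𝓝[>] 0, t < δ := nhdsWithin_le_nhds (gt_mem_nhds hδ)
  obtain ⟨t, ⟨⟨htU, htl⟩, htδ⟩, ht0⟩ := (((ht1.eventually hpU).and
    (ht2.eventually (gt_mem_nhds (lt_min (lt_min (half_pos hρ) hr) hδ)))).and ht3).and
      self_mem_nhdsWithin |>.exists
  have ht0 : 0 < t := ht0
  have hbaseV : (xbar, v) ∈ V := (hball (y := ((xbar, v), (xbar, v))) (by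
    simp only [Prod.dist_eq, dist_self]
    rw [dist_eq_norm]
    exact max_lt (max_lt hρ (by linarith)) (max_lt hρ (by linarith)))).2
  obtain ⟨⟨x', v'⟩, ⟨hs1, hs2⟩, hle⟩ := hUV p (mem_of_mem_nhds hpU) (p + t • q) htU (xbar, v)
    ⟨hsol, hbaseV⟩
  rw [sub_add_cancel_left, norm_neg, norm_smul, Real.norm_of_nonneg ht0.le] at hle
  simp only [Prod.fst_add, Prod.snd_add, Prod.smul_fst, Prod.smul_snd] at hs1 hs2
  have hx' : ‖x' - xbar‖ ≤ ℓ * (t * ‖q‖) := by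
    rw [norm_sub_rev]; exact (norm_fst_le _).trans hle
  have hv' : ‖v' - v‖ ≤ ℓ * (t * ‖q‖) := by
    rw [norm_sub_rev]; exact (norm_snd_le _).trans hle
  have htρ := htl.trans_le ((min_le_left _ _).trans (min_le_left _ _))
  have htr := htl.trans_le ((min_le_left _ _).trans (min_le_right _ _))
  have htδ' := htl.trans_le (min_le_right _ _)
  obtain ⟨⟨he1, he2⟩, -⟩ := hball (y := ((x', v'), (xbar, v))) (by
    simp only [Prod.dist_eq, dist_self]
    simp only [dist_eq_norm]
    have h1 : ‖v' - vbar‖ < ρ := by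
      calc ‖v' - vbar‖ = ‖(v' - v) + (v - vbar)‖ := by congr 1; abel
        _ ≤ ‖v' - v‖ + ‖v - vbar‖ := norm_add_le _ _
        _ < ρ := by linarith
    refine max_lt (max_lt (by linarith) h1) (max_lt hρ (by linarith)))
  obtain ⟨hηL, hyL⟩ := hδ' (y := (x', t)) (by
    simp only [Prod.dist_eq]
    simp only [dist_eq_norm, sub_zero, Real.norm_of_nonneg ht0.le]
    exact max_lt (by linarith) htδ) v' hs2 (by linarith)
  have hbound : c' * ‖(x', v') - (xbar, v)‖ ≤ t * c := by
    rw [norm_sub_rev]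
    calc c' * ‖(xbar, v) - (x', v')‖ ≤ c' * (ℓ * (t * ‖q‖)) := by gcongr
      _ = t * (c' * (ℓ * ‖q‖)) := by ring
      _ ≤ t * (c' * (ℓ * ‖q‖ + 1)) := by gcongr; linarith
      _ = t * c := by rw [hc']; field_simp
  have hdiv : ∀ {k : ℕ} (w : E k), ‖t • w‖ ≤ t * c → ‖w‖ ≤ c := fun w hw => by
    rw [norm_smul, Real.norm_of_nonneg ht0.le] at hw
    exact le_of_mul_le_mul_left hw ht0
  refine ⟨t⁻¹ • (x' - xbar), t⁻¹ • (v' - v), Submodule.smul_mem _ _ hηL, ?_,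
    t⁻¹ • (z - Φ xbar + t • q.2 + Φ x' - z), Submodule.smul_mem _ _ hyL, ?_⟩
  · refine hdiv _ (le_trans (le_of_eq ?_) (he1.trans hbound))
    have h1 : (t⁻¹ • (x' - xbar), t⁻¹ • (v' - v)) = t⁻¹ • ((x', v') - (xbar, v)) := rfl
    rw [h1, map_smul, smul_sub, smul_inv_smul₀ ht0.ne']
    simp only [← hs1, hp, add_sub_cancel_left]
  · refine hdiv _ (le_trans (le_of_eq ?_) (he2.trans hbound))
    have h1 : t • T (t⁻¹ • (x' - xbar)) = T (x' - xbar) := by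
      rw [← map_smul, smul_inv_smul₀ ht0.ne']
    rw [smul_sub, smul_add, h1, smul_inv_smul₀ ht0.ne']
    simp only [ContinuousLinearMap.comp_apply, ContinuousLinearMap.coe_fst', Prod.fst_sub]
    congr 1
    abel

/-- The linearization of the KKT system along any face of `gph ∂θ` adjacent to the reference point
is nonsingular if the solution map is Lipschitz-like. -/
lemma eventually_linearization_injective (hθ : IsCPWL θ) {D : E n × E m →L[ℝ] E n}
    {T : E n →L[ℝ] E m}
    (hG : HasStrictFDerivAt (fun p : E n × E m => gradLagrangian φ₀ Φ p.1 p.2) D (xbar, vbar))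
    (hT : HasStrictFDerivAt Φ T xbar)
    (hLip : LipschitzLikeAround (solKKT φ₀ Φ θ) ((0, 0) : E n × E m) (xbar, vbar)) :
    ∀ᶠ z in 𝓝 (Φ xbar), vbar ∈ subdiff θ z → ∀ (ξ : E n) (η : E m),
      η ∈ (affineSpan ℝ (subdiff θ z)).direction →
      T ξ ∈ (affineSpan ℝ (subdiff θ z)).directionᗮ → D (ξ, η) = 0 → ξ = 0 ∧ η = 0 := by
  filter_upwards [exists_approx_solution hθ hG hT hLip] with z hz hvz ξ η hη hξ hD
  set L := (affineSpan ℝ (subdiff θ z)).direction with hL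
  -- Modulo `Lᗮ`, the condition on `T ξ` becomes its projection to `L`, which makes the system
  -- square.
  let A : E n × L →L[ℝ] E n × L :=
    (D.comp ((ContinuousLinearMap.fst ℝ (E n) L).prod
      (L.subtypeL.comp (ContinuousLinearMap.snd ℝ (E n) L)))).prod
    (L.orthogonalProjectionOnto.comp (T.comp (ContinuousLinearMap.fst ℝ (E n) L)))
  have hA : ∀ x : E n, ∀ w : L, A (x, w) = (D (x, w), L.orthogonalProjectionOnto (T x)) :=
    fun _ _ => rfl
  have hdense : ∀ q : E n × L, q ∈ LinearMap.range (A : E n × L →ₗ[ℝ] E n × L) := by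
    intro q
    have hcl : IsClosed (LinearMap.range (A : E n × L →ₗ[ℝ] E n × L) : Set (E n × L)) :=
      Submodule.closed_of_finiteDimensional _
    rw [← SetLike.mem_coe, ← hcl.closure_eq, Metric.mem_closure_iff]
    intro c hc
    -- The sign: `-q.2 + T x` is close to `Lᗮ`, so `T x` projects near `q.2`.
    obtain ⟨x, w, hw, h1, y, hy, h2⟩ := hz hvz (q.1, -(q.2 : E m)) (c / 2) (half_pos hc)
    refine ⟨A (x, ⟨w, hw⟩), ⟨_, rfl⟩, ?_⟩
    rw [hA, dist_eq_norm]
    refine lt_of_le_of_lt (b := c / 2) ?_ (half_lt_self hc)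
    refine max_le h1 ?_
    have hy0 : L.orthogonalProjectionOnto y = 0 :=
      Submodule.orthogonalProjectionOnto_apply_of_mem_orthogonal hy
    have : q.2 - L.orthogonalProjectionOnto (T x) =
        L.orthogonalProjectionOnto (y - (-(q.2 : E m) + T x)) := by
      rw [map_sub, map_add, map_neg, hy0, Submodule.orthogonalProjectionOnto_mem_subspace_eq_self]
      abel
    change ‖q.2 - L.orthogonalProjectionOnto (T x)‖ ≤ c / 2
    rw [this]
    exact (L.norm_orthogonalProjectionOnto_apply_le _).trans h2
  have hinj : Function.Injective (A : E n × L →ₗ[ℝ] E n × L) :=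
    LinearMap.injective_iff_surjective.2 fun q => hdense q
  have h0 : A (ξ, ⟨η, hη⟩) = 0 := by
    rw [hA, Submodule.orthogonalProjectionOnto_apply_of_mem_orthogonal hξ]
    simp [hD]
  have := hinj (a₁ := (ξ, ⟨η, hη⟩)) (a₂ := 0) (by simpa using h0)
  simpa using this

end Aubin

/-! ### Local reduction of `θ` to the subspace `L` -/

section Reduction

variable {m s : ℕ} {θ : E m → EReal}

lemma IsCPWL.comp_affine_sub_inner (h : IsCPWL θ) (S : E s →L[ℝ] E m) (c a₀ : E m) :
    IsCPWL (fun y => θ (c + S y) + ((-⟪a₀, c + S y⟫ : ℝ) : EReal)) := by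
  obtain ⟨l, q, a, α, d, β, h⟩ := h
  refine ⟨l, q, fun i => S.adjoint (a i - a₀), fun i => α i - ⟪a i - a₀, c⟫,
    fun j => S.adjoint (d j), fun j => β j - ⟪d j, c⟫, fun y => ?_⟩
  have hiff : (∀ j, ⟪S.adjoint (d j), y⟫ ≤ β j - ⟪d j, c⟫) ↔ ∀ j, ⟪d j, c + S y⟫ ≤ β j := by
    refine forall_congr' fun j => ?_
    rw [ContinuousLinearMap.adjoint_inner_left, inner_add_right, le_sub_iff_add_le']
  constructor
  · intro hy
    simp only
    rw [(h _).1 (hiff.1 hy), ← EReal.coe_add, Finset.sup'_add]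
    congr 3
    ext i
    rw [ContinuousLinearMap.adjoint_inner_left]
    simp only [inner_sub_left, inner_add_right]
    ring
  · intro hy
    simp only
    rw [(h _).2 fun hy' => hy (hiff.2 hy'), EReal.top_add_coe]

/-- Around `z`, a convex piecewise linear function is affine with slope `a₀ ∈ aff ∂θ(z)` in
directions orthogonal to `aff ∂θ(z)`. -/
lemma IsCPWL.exists_nhds_eq_add_inner (h : IsCPWL θ) {z v a₀ : E m} (hv : v ∈ subdiff θ z)
    (ha₀ : a₀ ∈ affineSpan ℝ (subdiff θ z)) :
    ∃ N ∈ 𝓝 z, ∀ y ∈ N, ∀ y' ∈ N, y - y' ∈ (affineSpan ℝ (subdiff θ z)).directionᗮ →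
      θ y = θ y' + ((⟪a₀, y - y'⟫ : ℝ) : EReal) := by
  obtain ⟨l, q, a, α, d, β, h⟩ := h.exists_isRepresentedBy
  have hz := (h.mem_subdiff_iff.1 hv).1
  -- Adding an active constraint normal to a subgradient gives a subgradient.
  have hd : ∀ j, ⟪d j, z⟫ = β j → d j ∈ (affineSpan ℝ (subdiff θ z)).direction := by
    intro j hj
    have : v + d j ∈ subdiff θ z := by
      rw [h.subdiff_eq hz] at hv ⊢
      intro w hw
      obtain ⟨i, hi, hi'⟩ := hv w hw
      refine ⟨i, hi, ?_⟩
      rw [inner_add_left]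
      linarith [hw j hj]
    simpa using AffineSubspace.vsub_mem_direction (subset_affineSpan ℝ _ this)
      (subset_affineSpan ℝ _ hv)
  have ha : ∀ i, ⟪a i, z⟫ - α i = affineMax a α z →
      a i - a₀ ∈ (affineSpan ℝ (subdiff θ z)).direction := by
    intro i hi
    have : a i ∈ subdiff θ z := by
      rw [h.subdiff_eq hz]
      exact fun w _ => ⟨i, hi, le_rfl⟩
    exact AffineSubspace.vsub_mem_direction (subset_affineSpan ℝ _ this) ha₀
  refine ⟨_, eventually_active a α d β z, ?_⟩
  have hfeas : ∀ y y' : E m, (∀ j, ⟪d j, z⟫ < β j → ⟪d j, y'⟫ < β j) →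
      y - y' ∈ (affineSpan ℝ (subdiff θ z)).directionᗮ → (∀ j, ⟪d j, y⟫ ≤ β j) →
      ∀ j, ⟪d j, y'⟫ ≤ β j := by
    intro y y' hy' hyy hy j
    rcases (hz j).lt_or_eq with hj | hj
    · exact (hy' j hj).le
    · have := (Submodule.mem_orthogonal _ _).1 hyy _ (hd j hj)
      rw [inner_sub_right] at this
      linarith [hy j]
  have hmax : ∀ y y' : E m,
      (∀ i, ⟪a i, y⟫ - α i = affineMax a α y → ⟪a i, z⟫ - α i = affineMax a α z) →
      y - y' ∈ (affineSpan ℝ (subdiff θ z)).directionᗮ →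
      affineMax a α y ≤ affineMax a α y' + ⟪a₀, y - y'⟫ := by
    intro y y' hy hyy
    obtain ⟨i, hi⟩ := exists_affineMax_eq a α y
    have h1 := (Submodule.mem_orthogonal _ _).1 hyy _ (ha i (hy i hi))
    have h2 := le_affineMax (a := a) (α := α) i y'
    rw [inner_sub_left, inner_sub_right (a i)] at h1
    linarith
  rintro y ⟨hy1, hy2⟩ y' ⟨hy1', hy2'⟩ hyy
  have hyy' : y' - y ∈ (affineSpan ℝ (subdiff θ z)).directionᗮ := by
    rw [← neg_sub]; exact Submodule.neg_mem _ hyy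
  by_cases hf : ∀ j, ⟪d j, y⟫ ≤ β j
  · rw [(h y).1 hf, (h y').1 (hfeas y y' hy2' hyy hf), ← EReal.coe_add]
    congr 1
    refine le_antisymm (hmax y y' hy1 hyy) ?_
    have := hmax y' y hy1' hyy'
    rw [← neg_sub y y', inner_neg_right] at this
    linarith
  · rw [(h y).2 hf, (h y').2 fun hf' => hf (hfeas y' y hy2 hyy' hf'), EReal.top_add_coe]

lemma IsCPWL.exists_isLocalReduction (h : IsCPWL θ) {z v a₀ : E m} (hv : v ∈ subdiff θ z)
    (ha₀ : a₀ ∈ affineSpan ℝ (subdiff θ z)) :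
    ∃ s ≤ m, ∃ (B : E m →L[ℝ] E s) (ϑ : E s → EReal), IsLocalReduction θ z a₀ B ϑ := by
  set L := (affineSpan ℝ (subdiff θ z)).direction with hL
  let e : L ≃ₗᵢ[ℝ] E (Module.finrank ℝ L) := (stdOrthonormalBasis ℝ L).repr
  let B : E m →L[ℝ] E (Module.finrank ℝ L) :=
    (e.toContinuousLinearEquiv : L →L[ℝ] _).comp L.orthogonalProjectionOnto
  let S : E (Module.finrank ℝ L) →L[ℝ] E m :=
    L.subtypeL.comp (e.symm.toContinuousLinearEquiv : _ →L[ℝ] L)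
  have hB : ∀ y, B y = e (L.orthogonalProjectionOnto y) := fun _ => rfl
  have hS : ∀ y, S y = e.symm y := fun _ => rfl
  have hSB : ∀ y, S (B y) = L.starProjection y := fun y => by
    rw [hS, hB, e.symm_apply_apply, Submodule.starProjection_apply]
  obtain ⟨N, hN, hloc⟩ := h.exists_nhds_eq_add_inner hv ha₀
  -- `B` is the projection to `L` in orthonormal coordinates; `ϑ` evaluates `θ - ⟪a₀, ·⟫` on the
  -- slice `z + L`.
  refine ⟨Module.finrank ℝ L, ?_, B, _, h.comp_affine_sub_inner S (z - S (B z)) a₀, ?_, ?_⟩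
  · simpa using Submodule.finrank_le L
  · have hcont : Tendsto (fun y => z - S (B z) + S (B y)) (𝓝 z) (𝓝 z) := by
      have : Continuous fun y => z - S (B z) + S (B y) := by fun_prop
      simpa using this.tendsto z
    filter_upwards [hN, hcont hN] with y hy hy'
    have hperp : y - (z - S (B z) + S (B y)) ∈ Lᗮ := by
      have h1 : y - (z - S (B z) + S (B y)) = (y - z) - L.starProjection (y - z) := by
        rw [hSB, hSB, map_sub]; abel
      rw [h1]
      exact L.sub_starProjection_mem_orthogonal _
    rw [hloc y hy _ hy' hperp, add_assoc, ← EReal.coe_add, inner_sub_right]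
    congr 2
    ring
  · ext y
    rw [← hL, LinearMap.mem_ker, ContinuousLinearMap.coe_coe, hB, map_eq_zero_iff _ e.injective,
      Submodule.orthogonalProjectionOnto_eq_zero_iff]

end Reduction

/-! ### Nondegeneracy, tangent directions and uniqueness of multipliers -/

/-- If the adjoint of the derivative is injective on the orthogonal complement of `ker B`, the
point is nondegenerate. -/
lemma isNondegenerate_of_adjoint {n m s : ℕ} {Φ : E n → E m} {x : E n} {B : E m →L[ℝ] E s}
    {L : Submodule ℝ (E m)} (hB : LinearMap.ker (B : E m →ₗ[ℝ] E s) = Lᗮ)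
    (h : ∀ η ∈ L, (fderiv ℝ Φ x).adjoint η = 0 → η = 0) : IsNondegenerate Φ x B := by
  rw [IsNondegenerate, hB, ← Submodule.orthogonal_eq_bot_iff, ← Submodule.inf_orthogonal,
    Submodule.orthogonal_orthogonal, ContinuousLinearMap.orthogonal_range, eq_bot_iff]
  rintro η ⟨h1, h2⟩
  exact h η h2 h1

/-- A tangent direction to `gph ∂θ` at `(z, v)` belongs to `Lᗮ × L` for the subspace `L` parallel
to `aff ∂θ(y)` at points `y` arbitrarily close to `z`. -/
lemma IsCPWL.exists_face_of_graphicalDeriv {m : ℕ} {θ : E m → EReal} (h : IsCPWL θ)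
    {z v u η : E m} (hv : v ∈ subdiff θ z) (hη : η ∈ graphicalDeriv (subdiff θ) z v u)
    {P : E m → Prop} (hP : ∀ᶠ y in 𝓝 z, P y) :
    ∃ y, P y ∧ v ∈ subdiff θ y ∧ η ∈ (affineSpan ℝ (subdiff θ y)).direction ∧
      u ∈ (affineSpan ℝ (subdiff θ y)).directionᗮ := by
  obtain ⟨p, α, hp, -, hlim, hdir⟩ := hη
  have hp1 : Tendsto (fun k => (p k).1) atTop (𝓝 z) := (continuous_fst.tendsto _).comp hlim
  have hp2 : Tendsto (fun k => (p k).2) atTop (𝓝 v) := (continuous_snd.tendsto _).comp hlim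
  have hd1 : Tendsto (fun k => α k • ((p k).1 - z)) atTop (𝓝 u) :=
    (continuous_fst.tendsto _).comp hdir
  have hd2 : Tendsto (fun k => α k • ((p k).2 - v)) atTop (𝓝 η) :=
    (continuous_snd.tendsto _).comp hdir
  -- Pigeonhole: only finitely many sets occur as subdifferentials.
  obtain ⟨C, hC⟩ : ∃ C, ∃ᶠ k in atTop, subdiff θ (p k).1 = C := by
    by_contra hcon
    have : ∀ C ∈ Set.range (subdiff θ), ∀ᶠ k in atTop, subdiff θ (p k).1 ≠ C := fun C _ =>
      not_frequently.1 fun hf => hcon ⟨C, hf⟩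
    obtain ⟨k, hk⟩ := ((eventually_all_finite h.finite_range_subdiff).2 this).exists
    exact hk _ ⟨_, rfl⟩ rfl
  obtain ⟨k₀, hk₀⟩ := hC.exists
  have hCcl : IsClosed C := hk₀ ▸ h.isClosed_subdiff _
  have hvC : v ∈ C := hCcl.mem_of_frequently_of_tendsto (hC.mono fun k hk => hk ▸ hp k) hp2
  have hηL : η ∈ (affineSpan ℝ C).direction := by
    refine (Submodule.closed_of_finiteDimensional _).mem_of_frequently_of_tendsto
      (hC.mono fun k hk => ?_) hd2
    exact Submodule.smul_mem _ _ (AffineSubspace.vsub_mem_direction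
      (subset_affineSpan ℝ _ (hk ▸ hp k)) (subset_affineSpan ℝ _ hvC))
  have huL : u ∈ (affineSpan ℝ C).directionᗮ := by
    refine (Submodule.isClosed_orthogonal _).mem_of_frequently_of_tendsto
      ((hC.and_eventually (hp1.eventually (h.eventually_subdiff_subset ⟨v, hv⟩))).mono
        fun k hk => ?_) hd1
    have := h.sub_mem_orthogonal hk.2
    rw [hk.1] at this
    exact Submodule.smul_mem _ _ this
  obtain ⟨k, hk, hPk⟩ := (hC.and_eventually (hp1.eventually hP)).exists
  exact ⟨(p k).1, hPk, by rwa [hk], by rwa [hk], by rwa [hk]⟩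

/-- Injectivity is an open condition on operators from the finite-dimensional `L`. -/
lemma eventually_adjoint_injOn {n m : ℕ} {Φ : E n → E m} {x : E n} (hΦ : ContDiffAt ℝ 2 Φ x)
    {L : Submodule ℝ (E m)} (h : ∀ η ∈ L, (fderiv ℝ Φ x).adjoint η = 0 → η = 0) :
    ∀ᶠ y in 𝓝 x, ∀ η ∈ L, (fderiv ℝ Φ y).adjoint η = 0 → η = 0 := by
  have hcont : ContinuousAt (fun y => (fderiv ℝ Φ y).adjoint.comp L.subtypeL) x := by
    have h1 : ContinuousAt (fderiv ℝ Φ) x :=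
      (hΦ.fderiv_right (m := 1) (by norm_num)).continuousAt
    have h2 := (ContinuousLinearMap.adjoint (𝕜 := ℝ) (E := E n) (F := E m)).continuous
    exact (h2.continuousAt.comp h1).clm_comp continuousAt_const
  have hinj : Function.Injective ((fderiv ℝ Φ x).adjoint.comp L.subtypeL) := by
    rw [injective_iff_map_eq_zero]
    exact fun η hη => Subtype.ext (h η η.2 hη)
  filter_upwards [hcont.eventually (ContinuousLinearMap.isOpen_injective.mem_nhds hinj)]
    with y hy η hη h0
  exact congrArg Subtype.val ((injective_iff_map_eq_zero _).1 hy ⟨η, hη⟩ h0)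

lemma solKKT_eq_perturbedMultipliers {n m : ℕ} {φ₀ : E n → ℝ} {Φ : E n → E m} {θ : E m → EReal}
    {p : E n × E m} {x : E n} {v : E m} :
    (x, v) ∈ solKKT φ₀ Φ θ p ↔ v ∈ perturbedMultipliers φ₀ Φ θ p x := by
  simp only [solKKT, perturbedMultipliers, Set.mem_ofPred_eq, add_comm]

/-- Points near the reference point have at most one multiplier under small perturbations. -/
lemma eventually_multiplier_unique {n m : ℕ} {φ₀ : E n → ℝ} {Φ : E n → E m} {θ : E m → EReal}
    {x : E n} (hφ₀ : ContDiffAt ℝ 2 φ₀ x) (hΦ : ContDiffAt ℝ 2 Φ x) (hθ : IsCPWL θ)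
    (hne : (subdiff θ (Φ x)).Nonempty)
    (hinj : ∀ η ∈ (affineSpan ℝ (subdiff θ (Φ x))).direction,
      (fderiv ℝ Φ x).adjoint η = 0 → η = 0) :
    ∀ᶠ q : (E n × E m) × E n in 𝓝 ((0, 0), x), ∀ v ∈ perturbedMultipliers φ₀ Φ θ q.1 q.2,
      ∀ w ∈ perturbedMultipliers φ₀ Φ θ q.1 q.2, w = v := by
  have h1 : Tendsto (fun q : (E n × E m) × E n => q.2) (𝓝 ((0, 0), x)) (𝓝 x) :=
    continuous_snd.tendsto _
  have h2 : Tendsto (fun q : (E n × E m) × E n => Φ q.2 + q.1.2) (𝓝 ((0, 0), x)) (𝓝 (Φ x)) := by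
    have h3 : ContinuousAt (fun q : (E n × E m) × E n => Φ q.2) ((0, 0), x) :=
      ContinuousAt.comp (f := fun q : (E n × E m) × E n => q.2) hΦ.continuousAt continuousAt_snd
    have h4 : ContinuousAt (fun q : (E n × E m) × E n => q.1.2) ((0, 0), x) := by fun_prop
    have h5 : Tendsto (fun q : (E n × E m) × E n => Φ q.2 + q.1.2) (𝓝 ((0, 0), x))
        (𝓝 (Φ x + 0)) := h3.add h4
    rwa [add_zero] at h5
  filter_upwards [h1.eventually (eventually_gradLagrangian_eq hφ₀ hΦ),
    h1.eventually (eventually_adjoint_injOn hΦ hinj),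
    h2.eventually (hθ.eventually_subdiff_subset hne)] with q hq1 hq2 hq3 v hv w hw
  rw [← sub_eq_zero]
  refine hq2 _ (AffineSubspace.vsub_mem_direction (subset_affineSpan ℝ _ (hq3 hw.2))
    (subset_affineSpan ℝ _ (hq3 hv.2))) ?_
  have h := hw.1.symm.trans hv.1
  rw [hq1, hq1] at h
  rw [map_sub, sub_eq_zero]
  exact add_left_cancel h

end CompositeKKT

open CompositeKKT in
theorem theorem8p2 (n m : ℕ) (φ₀ : E n → ℝ) (Φ : E n → E m) (θ : E m → EReal)
    (xbar : E n) (vbar : E m)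
    (hφ₀ : ContDiffAt ℝ 2 φ₀ xbar) (hΦ : ContDiffAt ℝ 2 Φ xbar)
    (hθ : IsCPWL θ)
    (hLip : LipschitzLikeAround (solKKT φ₀ Φ θ) ((0, 0) : E n × E m) (xbar, vbar)) :
    (∀ a ∈ affineSpan ℝ (subdiff θ (Φ xbar)),
      ∃ s ≤ m, ∃ (B : E m →L[ℝ] E s) (ϑ : E s → EReal),
        IsLocalReduction θ (Φ xbar) a B ϑ ∧ IsNondegenerate Φ xbar B) ∧
    (∃ O ∈ 𝓝 ((0, 0) : E n × E m), ∃ ε > 0, ∀ p ∈ O,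
      (solKKT φ₀ Φ θ p ∩ Metric.closedBall (xbar, vbar) ε).Nonempty ∧
      ∀ x v, (x, v) ∈ solKKT φ₀ Φ θ p ∩ Metric.closedBall (xbar, vbar) ε →
        perturbedMultipliers φ₀ Φ θ p x = {v}) ∧
    (multipliersCom φ₀ Φ θ xbar = {vbar} ∧
      IsNoncritical (gradLagrangian φ₀ Φ) Φ θ xbar vbar) := by
  have hmult : vbar ∈ perturbedMultipliers φ₀ Φ θ (0, 0) xbar :=
    solKKT_eq_perturbedMultipliers.1 hLip.1
  have hvbar : vbar ∈ subdiff θ (Φ xbar) := by simpa using hmult.2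
  have hD := fderiv_gradLagrangian_apply hφ₀ hΦ vbar
  have hface := eventually_linearization_injective hθ
    ((contDiffAt_gradLagrangian hφ₀ hΦ vbar).hasStrictFDerivAt (by simp))
    (hΦ.hasStrictFDerivAt (by simp)) hLip
  have hinj : ∀ η ∈ (affineSpan ℝ (subdiff θ (Φ xbar))).direction,
      (fderiv ℝ Φ xbar).adjoint η = 0 → η = 0 := fun η hη h0 =>
    (hface.self_of_nhds hvbar 0 η hη (by simp) (by rw [hD, h0]; simp)).2
  have huniq := eventually_multiplier_unique hφ₀ hΦ hθ ⟨vbar, hvbar⟩ hinj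
  have hcom : multipliersCom φ₀ Φ θ xbar = perturbedMultipliers φ₀ Φ θ (0, 0) xbar := by
    ext v
    simp [multipliersCom, multipliers, perturbedMultipliers, eq_comm]
  refine ⟨fun a ha => ?_, ?_, ?_, ?_, ?_⟩
  · obtain ⟨s, hs, B, ϑ, hred⟩ := hθ.exists_isLocalReduction hvbar ha
    exact ⟨s, hs, B, ϑ, hred, isNondegenerate_of_adjoint hred.2.2 hinj⟩
  · obtain ⟨ε, hε, hball⟩ := Metric.eventually_nhds_iff.1 huniq
    obtain ⟨hsol, U, hU, V, hV, ℓ, -, hUV⟩ := hLip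
    have hsmall : ∀ᶠ p : E n × E m in 𝓝 (0, 0), ℓ * ‖(0, 0) - p‖ < ε / 2 := by
      have : Continuous fun p : E n × E m => ℓ * ‖(0, 0) - p‖ := by fun_prop
      refine this.continuousAt.eventually (gt_mem_nhds ?_)
      simpa using hε
    -- Halving puts the closed ball inside the open ball where multipliers are unique.
    refine ⟨_, inter_mem hU (inter_mem hsmall (Metric.ball_mem_nhds _ (half_pos hε))), ε / 2, half_pos hε, ?_⟩
    rintro p ⟨hpU, hpℓ, hpε⟩
    constructor
    · obtain ⟨y, hy, hle⟩ := hUV (0, 0) (mem_of_mem_nhds hU) p hpU (xbar, vbar)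
        ⟨hsol, mem_of_mem_nhds hV⟩
      refine ⟨y, hy, ?_⟩
      rw [Metric.mem_closedBall', dist_eq_norm]
      exact hle.trans hpℓ.le
    · rintro x v ⟨hxv, hdist⟩
      have hv := solKKT_eq_perturbedMultipliers.1 hxv
      have hx : dist x xbar ≤ ε / 2 := (le_max_left _ _).trans hdist
      refine Set.eq_singleton_iff_unique_mem.2 ⟨hv, fun w hw => ?_⟩
      refine hball (y := (p, x)) ?_ v hv w hw
      exact max_lt (hpε.trans (half_lt_self hε)) (hx.trans_lt (half_lt_self hε))
  · rw [hcom]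
    exact Set.eq_singleton_iff_unique_mem.2
      ⟨hmult, fun w hw => huniq.self_of_nhds vbar hmult w hw⟩
  · exact hcom.ge hmult
  · rintro ⟨-, ξ, hξ, η, hη, h0⟩
    obtain ⟨y, hy, hvy, hηL, huL⟩ := hθ.exists_face_of_graphicalDeriv hvbar hη hface
    exact hξ (hy hvy ξ η hηL huL (by rw [hD, h0])).1
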